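/- All languages are relational, with predicate symbols of positive arity. For nonempty structures $\mathcal A_i$ ($i\in I$) in a language $\Sigma$, the $E$-combination ${\rm Comb}_E(\mathcal A_i)_{i\in I}$ is the disjoint union of the $\mathcal A_i$ (a predicate of $\Sigma$ holds exactly for the tuples that lie in one $\mathcal A_i$ and satisfy it there), expanded by a new equivalence relation $E$ whose classes are the universes of the $\mathcal A_i$. For a set $\mathcal T$ of complete $\Sigma$-theories, ${\rm Cl}_E(\mathcal T)$ is the set of all theories ${\rm Th}(\mathcal B)$, where $\mathcal B$ is the restriction to some $E$-class (in the language $\Sigma$) of a structure elementarily equivalent to some ${\rm Comb}_E(\mathcal A_i)_{i\in I}$ with all ${\rm Th}(\mathcal A_i)\in\mathcal T$. The set $\mathcal T$ is $E$-closed if ${\rm Cl}_E(\mathcal T)=\mathcal T$. A generating set for an $E$-closed $\mathcal T$ is a subset $\mathcal G\subseteq\mathcal T$ with ${\rm Cl}_E(\mathcal G)=\mathcal T$; it is minimal if no proper subset of it is generating for $\mathcal T$, and a minimal generating set is least if it is contained in every generating set for $\mathcal T$. If $\Sigma_0\subseteq\Sigma_0'$, a complete $\Sigma_0'$-theory $T'$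 is an expansion of a $\Sigma_0$-theory $T$ if $T$ is the set of the $\Sigma_0$-sentences in $T'$. **Proposition 3.4.** There are languages $\Sigma_0\subseteq\Sigma_0'$ and an $E$-closed family $\mathcal T_0$ of complete theories in the language $\Sigma_0$, with the least generating set, which can be transformed to an $E$-closed family $\mathcal T_0'$ of complete theories in the language $\Sigma_0'$ such that $\mathcal T_0'$ consists of expansions of theories in $\mathcal T_0$ and $\mathcal T_0'$ does not have the least generating set. Here "transformed" means that one can choose for every $T\in\mathcal T_0$ an expansion $e(T)$ in the language $\Sigma_0'$ such that $\mathcal T_0'={\rm Cl}_E(\{e(T)\mid T\in\mathcal T_0\})$. -/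

import Mathlib

open FirstOrder

namespace ECombination

/-- A relational (predicate) language: there are no function or constant symbols, and every
predicate symbol has positive arity (a nullary predicate would take a single truth value in an
`E`-combination, so that the `E`-classes could not be recovered from it). -/
class IsPredicateLanguage (L : FirstOrder.Language.{0, 0}) : Prop where
  isEmpty_functions : ∀ n, IsEmpty (L.Functions n)
  isEmpty_nullary : IsEmpty (L.Relations 0)

instance (L : FirstOrder.Language.{0, 0}) [h : IsPredicateLanguage L] (n : ℕ) : IsEmpty (L.Functions n) :=
  h.isEmpty_functions n

/-- The only new symbol of an `E`-combination: a binary predicate `E`. -/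
inductive ESymbol : ℕ → Type
  | E : ESymbol 2

/-- The language whose only symbol is the binary predicate `E`. -/
def eLanguage : FirstOrder.Language.{0, 0} := ⟨fun _ => Empty, ESymbol⟩

/-- The language `L` together with the new binary predicate `E`. -/
abbrev withE (L : FirstOrder.Language.{0, 0}) : FirstOrder.Language.{0, 0} := L.sum eLanguage

/-- The universe of the `E`-combination of the structures `A i`: their disjoint union. -/
def EComb {I : Type} (A : I → Type) : Type := Σ i, A i

/-- The `E`-combination of the structures `A i`: a predicate of `L` holds exactly for the tuples
that lie in a single `A i` and satisfy the predicate there; the classes of `E` are the `A i`. -/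
instance eCombStructure (L : FirstOrder.Language.{0, 0}) [IsPredicateLanguage L] {I : Type} (A : I → Type)
    [∀ i, L.Structure (A i)] : (withE L).Structure (EComb A) where
  funMap := fun f _ => Sum.elim (fun g => isEmptyElim g) (fun g => Empty.elim g) f
  RelMap := fun {n} r x => Sum.elim
    (fun s : L.Relations n =>
      ∃ (i : I) (y : Fin n → A i), (∀ k, x k = ⟨i, y k⟩) ∧ FirstOrder.Language.Structure.RelMap s y)
    (fun s : ESymbol n => match n, s, x with
      | _, ESymbol.E, x => (x 0).1 = (x 1).1) r

/-- The interpretation of the predicate `E` in a structure for the language with `E`. -/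
def ERel (L : FirstOrder.Language.{0, 0}) {M : Type} [(withE L).Structure M] (a b : M) : Prop :=
  FirstOrder.Language.Structure.RelMap (L := withE L) (n := 2) (Sum.inr ESymbol.E) ![a, b]

/-- The universe of the `E`-class of the element `a`. -/
def EClass (L : FirstOrder.Language.{0, 0}) {M : Type} [(withE L).Structure M] (a : M) : Type :=
  {b : M // ERel L a b}

/-- An `E`-class, as a structure for `L`: the restriction of the `L`-reduct of `M` to the class. -/
instance eClassStructure (L : FirstOrder.Language.{0, 0}) [IsPredicateLanguage L] {M : Type}
    [(withE L).Structure M] (a : M) : L.Structure (EClass L a) where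
  funMap := fun f _ => isEmptyElim f
  RelMap := fun r x =>
    FirstOrder.Language.Structure.RelMap (L := withE L) (M := M) (Sum.inl r) (fun k => (x k).1)

/-- The `E`-closure of a set `𝒯` of complete theories: the set of the theories `Th(B)`, where `B`
is an `E`-class of a structure elementarily equivalent to the `E`-combination of some nonempty
structures `A i` with `Th(A i) ∈ 𝒯`. -/
def ClE {L : FirstOrder.Language.{0, 0}} [IsPredicateLanguage L] (𝒯 : Set L.Theory) : Set L.Theory :=
  {T | ∃ (I : Type) (A : I → Type) (_ : ∀ i, L.Structure (A i)) (M : Type)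
      (_ : (withE L).Structure M) (a : M),
      (∀ i, Nonempty (A i)) ∧ (∀ i, L.completeTheory (A i) ∈ 𝒯) ∧
      (withE L).ElementarilyEquivalent M (EComb A) ∧ T = L.completeTheory (EClass L a)}

/-- A set of theories is `E`-closed if it equals its `E`-closure. All its members are then complete
theories of nonempty structures. -/
def IsEClosed {L : FirstOrder.Language.{0, 0}} [IsPredicateLanguage L] (𝒯 : Set L.Theory) : Prop :=
  ClE 𝒯 = 𝒯

/-- `𝒢` is a generating set for `𝒯`. -/
def IsGenerating {L : FirstOrder.Language.{0, 0}} [IsPredicateLanguage L] (𝒢 𝒯 : Set L.Theory) : Prop :=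
  𝒢 ⊆ 𝒯 ∧ ClE 𝒢 = 𝒯

/-- `𝒢` is a minimal generating set for `𝒯`: it has no proper generating subset. -/
def IsMinimalGenerating {L : FirstOrder.Language.{0, 0}} [IsPredicateLanguage L]
    (𝒢 𝒯 : Set L.Theory) : Prop :=
  IsGenerating 𝒢 𝒯 ∧ ∀ 𝒢', 𝒢' ⊂ 𝒢 → ¬ IsGenerating 𝒢' 𝒯

/-- `𝒢` is the least generating set for `𝒯`: it is minimal, and contained in each generating
set. -/
def IsLeastGenerating {L : FirstOrder.Language.{0, 0}} [IsPredicateLanguage L]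
    (𝒢 𝒯 : Set L.Theory) : Prop :=
  IsMinimalGenerating 𝒢 𝒯 ∧ ∀ 𝒢', IsGenerating 𝒢' 𝒯 → 𝒢 ⊆ 𝒢'

/-- `𝒯` has the least generating set. -/
def HasLeastGenerating {L : FirstOrder.Language.{0, 0}} [IsPredicateLanguage L] (𝒯 : Set L.Theory) : Prop :=
  ∃ 𝒢, IsLeastGenerating 𝒢 𝒯

/-- For an inclusion `ι` of a language `L₀` into `L₁`: the complete `L₁`-theory `T'` is an expansion
of the `L₀`-theory `T`, i.e. `T` consists of the `L₀`-sentences that belong to `T'`. -/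
def IsExpansion {L₀ L₁ : FirstOrder.Language.{0, 0}} (ι : L₀ →ᴸ L₁) (T : L₀.Theory) (T' : L₁.Theory) : Prop :=
  T'.IsMaximal ∧ T = {φ | ι.onSentence φ ∈ T'}

end ECombination

open ECombination

open ECombination
open FirstOrder FirstOrder.Language Filter Topology

/-! With unary predicates indexed by `α`, complete theories of one-element structures are points of
the Cantor-type space `α → Bool`, and on sets of them `ClE` is topological closure
(`clE_image_pointTheory`). Generating sets of a closed set `K` are then its dense subsets: dense
isolated points form the least one, while a nonempty relatively open part without isolated points
excludes any minimal one. In `markedSet` the points with `y ≠ 0` are isolated and dense, and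
accumulate on the Cantor set `y = 0`. One new predicate, true exactly when `y = 0`, cuts this Cantor
set off by an open condition. The closure of the expanded family thus has a perfect open part and no
least generating set. -/

/-- The symbols of the language of unary predicates indexed by `α`. -/
inductive UnarySymbol (α : Type) : ℕ → Type
  | P : α → UnarySymbol α 1

/-- The language of unary predicates indexed by `α`. -/
def unaryLanguage (α : Type) : FirstOrder.Language.{0, 0} := ⟨fun _ => Empty, UnarySymbol α⟩

/-- The predicate of index `k`. -/
def pred {α : Type} (k : α) : (unaryLanguage α).Relations 1 := UnarySymbol.P k

instance unaryLanguage_isPredicateLanguage (α : Type) : IsPredicateLanguage (unaryLanguage α) where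
  isEmpty_functions := fun _ => inferInstanceAs (IsEmpty Empty)
  isEmpty_nullary := ⟨fun r => by
    change UnarySymbol α 0 at r
    nomatch r⟩

/-! ### Theories of one-element structures as points of `α → Bool`. -/

/-- The one-element structure in which the true predicates are given by `s`. -/
def Point {α : Type} (_ : α → Bool) : Type := Unit

instance pointUnique {α : Type} (s : α → Bool) : Unique (Point s) := inferInstanceAs (Unique Unit)

instance pointStructure {α : Type} (s : α → Bool) : (unaryLanguage α).Structure (Point s) where
  funMap := fun f _ => isEmptyElim f
  RelMap := fun {n} (r : UnarySymbol α n) _ => match n, r with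
    | _, UnarySymbol.P k => s k = true

/-- The complete theory of a one-element structure. -/
def pointTheory {α : Type} (s : α → Bool) : (unaryLanguage α).Theory :=
  (unaryLanguage α).completeTheory (Point s)

/-- There are no two distinct elements. -/
def subsingletonSentence (L : FirstOrder.Language.{0, 0}) : L.Sentence :=
  ∀' ∀' ((&0 : L.Term (Empty ⊕ Fin 2)) =' &1)

/-- Some element satisfies the predicate `r`. -/
def existsSentence {L : FirstOrder.Language.{0, 0}} (r : L.Relations 1) : L.Sentence :=
  ∃' (r.boundedFormula₁ (&0 : L.Term (Empty ⊕ Fin 1)))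

theorem realize_subsingletonSentence (L : FirstOrder.Language.{0, 0}) (M : Type) [L.Structure M] :
    M ⊨ subsingletonSentence L ↔ Subsingleton M := by
  simp [subsingletonSentence, Sentence.Realize, Formula.Realize, Fin.snoc, subsingleton_iff]

theorem realize_existsSentence {L : FirstOrder.Language.{0, 0}} (r : L.Relations 1) (M : Type)
    [L.Structure M] :
    M ⊨ existsSentence r ↔ ∃ a : M, Structure.RelMap r ![a] := by
  simp [existsSentence, Sentence.Realize, Formula.Realize, Fin.snoc]

theorem existsSentence_mem_pointTheory {α : Type} (s : α → Bool) (k : α) :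
    existsSentence (pred k) ∈ pointTheory s ↔ s k = true := by
  rw [pointTheory, mem_completeTheory, realize_existsSentence]
  exact ⟨fun ⟨_, h⟩ => h, fun h => ⟨default, h⟩⟩

open Classical in
/-- The set of predicates that a theory declares to be nonempty. -/
noncomputable def trueSet {α : Type} (T : (unaryLanguage α).Theory) (k : α) : Bool :=
  decide (existsSentence (pred k) ∈ T)

theorem trueSet_pointTheory {α : Type} (s : α → Bool) : trueSet (pointTheory s) = s := by
  funext k
  simp [trueSet, existsSentence_mem_pointTheory]

theorem pointTheory_injective {α : Type} :
    Function.Injective (pointTheory : (α → Bool) → (unaryLanguage α).Theory) :=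
  Function.LeftInverse.injective trueSet_pointTheory

theorem completeTheory_eq_pointTheory {α : Type} {M : Type} [(unaryLanguage α).Structure M]
    [Unique M] {s : α → Bool}
    (h : ∀ k, Structure.RelMap (pred k) ![(default : M)] ↔ s k = true) :
    (unaryLanguage α).completeTheory M = pointTheory s := by
  let f : M ≃[unaryLanguage α] Point s :=
    { toEquiv := Equiv.ofUnique M (Point s)
      map_fun' := fun g => isEmptyElim g
      map_rel' := fun {n} (r : UnarySymbol α n) x => by
        cases r with
        | P k =>
          have hx : x = ![(default : M)] := funext fun _ => Subsingleton.elim _ _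
          rw [hx]
          exact (h k).symm }
  exact StrongHomClass.elementarilyEquivalent f

theorem of_completeTheory_eq_pointTheory {α : Type} {M : Type} [(unaryLanguage α).Structure M]
    {s : α → Bool} (h : (unaryLanguage α).completeTheory M = pointTheory s) :
    Subsingleton M ∧ ∀ (k : α) (a : M), Structure.RelMap (pred k) ![a] ↔ s k = true := by
  have hM : Subsingleton M := by
    rw [← realize_subsingletonSentence (unaryLanguage α), ← mem_completeTheory, h, pointTheory,
      mem_completeTheory, realize_subsingletonSentence]
    infer_instance
  refine ⟨hM, fun k a => ?_⟩
  rw [← existsSentence_mem_pointTheory, ← h, mem_completeTheory, realize_existsSentence]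
  exact ⟨fun ha => ⟨a, ha⟩, fun ⟨b, hb⟩ => Subsingleton.elim b a ▸ hb⟩

/-! ### `E`-closure as topological closure. -/

/-- The predicate `E`. -/
def eSymbol (L : FirstOrder.Language.{0, 0}) : (withE L).Relations 2 := Sum.inr ESymbol.E

/-- The predicate of index `k`, in the language with `E`. -/
def predWithE {α : Type} (k : α) : (withE (unaryLanguage α)).Relations 1 := Sum.inl (pred k)

/-- The predicate `E` holds between every element and itself, and between no others. -/
def diagonalSentence (L : FirstOrder.Language.{0, 0}) : (withE L).Sentence :=
  ∀' ∀' (((eSymbol L).boundedFormula₂ (&0 : (withE L).Term (Empty ⊕ Fin 2)) &1).iff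
    ((&0 : (withE L).Term (Empty ⊕ Fin 2)) =' &1))

theorem realize_diagonalSentence (L : FirstOrder.Language.{0, 0}) (M : Type) [(withE L).Structure M] :
    M ⊨ diagonalSentence L ↔ ∀ a b : M, ERel L a b ↔ a = b := by
  have : ∀ a b : M, ERel L a b ↔ Structure.RelMap (eSymbol L) ![a, b] := fun _ _ => Iff.rfl
  simp [diagonalSentence, Sentence.Realize, Formula.Realize, Fin.snoc, this]

/-- Some element satisfies exactly the predicates given by `s`, among those of index in `J`. -/
noncomputable def patternSentence {α : Type} (J : Finset α) (s : α → Bool) :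
    (withE (unaryLanguage α)).Sentence :=
  ∃' BoundedFormula.iInf fun k : J =>
    bif s k then (predWithE k.1).boundedFormula₁
      (&0 : (withE (unaryLanguage α)).Term (Empty ⊕ Fin 1))
    else ∼((predWithE k.1).boundedFormula₁
      (&0 : (withE (unaryLanguage α)).Term (Empty ⊕ Fin 1)))

theorem realize_patternSentence {α : Type} (J : Finset α) (s : α → Bool) (M : Type)
    [(withE (unaryLanguage α)).Structure M] :
    M ⊨ patternSentence J s ↔ ∃ a : M, ∀ k ∈ J,
      (Structure.RelMap (predWithE k) ![a] ↔ s k = true) := by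
  simp only [patternSentence, Sentence.Realize, Formula.Realize, BoundedFormula.realize_ex,
    BoundedFormula.realize_iInf, Subtype.forall]
  refine exists_congr fun a => forall₂_congr fun k _ => ?_
  cases s k <;> simp [Fin.snoc]

theorem eRel_eComb {L : FirstOrder.Language.{0, 0}} [IsPredicateLanguage L] {I : Type} {A : I → Type}
    [∀ i, L.Structure (A i)] (a b : EComb A) : ERel L a b ↔ a.1 = b.1 := Iff.rfl

theorem relMap_pred_eComb {α : Type} {I : Type} {A : I → Type}
    [∀ i, (unaryLanguage α).Structure (A i)] (k : α) (i : I) (a : A i) :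
    Structure.RelMap (M := EComb A) (predWithE k) ![⟨i, a⟩] ↔
      Structure.RelMap (pred k) ![a] := by
  constructor
  · rintro ⟨j, y, hy, h⟩
    have h0 : (⟨i, a⟩ : Σ i, A i) = ⟨j, y 0⟩ := hy 0
    obtain ⟨rfl, h0⟩ := Sigma.mk.inj_iff.1 h0
    have : ![a] = y := by
      funext l
      rw [Subsingleton.elim l 0]
      exact eq_of_heq h0
    rwa [this]
  · intro h
    refine ⟨i, ![a], fun l => ?_, h⟩
    rw [Subsingleton.elim l 0]
    rfl

theorem eComb_models_diagonalSentence {L : FirstOrder.Language.{0, 0}} [IsPredicateLanguage L] {I : Type}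
    {A : I → Type} [∀ i, L.Structure (A i)] [∀ i, Subsingleton (A i)] :
    EComb A ⊨ diagonalSentence L := by
  rw [realize_diagonalSentence]
  rintro ⟨i, a⟩ ⟨j, b⟩
  refine (eRel_eComb _ _).trans ⟨?_, fun h => congrArg Sigma.fst h⟩
  rintro (rfl : i = j)
  rw [Subsingleton.elim a b]

theorem completeTheory_eClass {α : Type} {M : Type} [(withE (unaryLanguage α)).Structure M]
    (hM : M ⊨ diagonalSentence (unaryLanguage α)) (a : M) {s : α → Bool}
    (h : ∀ k, Structure.RelMap (predWithE k) ![a] ↔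
      s k = true) :
    (unaryLanguage α).completeTheory (EClass (unaryLanguage α) a) = pointTheory s := by
  rw [realize_diagonalSentence] at hM
  let _ : Unique (EClass (unaryLanguage α) a) :=
    { default := ⟨a, (hM a a).2 rfl⟩
      uniq := fun b => Subtype.ext ((hM _ _).1 b.2).symm }
  refine completeTheory_eq_pointTheory fun k => ?_
  rw [← h k]
  have : (fun l => (![(default : EClass (unaryLanguage α) a)] l).1) = ![a] := by
    funext l
    rw [Subsingleton.elim l 0]
    rfl
  rw [← this]
  rfl

/-- Elementary equivalence keeps `E` diagonal, so every class is a single point. Any finite part of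
its pattern is expressed by one sentence, hence occurs in some `A i`: each basic neighbourhood of
the pattern meets `S`. -/
theorem clE_image_pointTheory_subset {α : Type} (S : Set (α → Bool)) :
    ClE (pointTheory '' S) ⊆ pointTheory '' closure S := by
  classical
  rintro T ⟨I, A, _, M, _, a, -, hS, hMA, rfl⟩
  choose t ht htA using hS
  have hA := fun i => of_completeTheory_eq_pointTheory (htA i).symm
  have : ∀ i, Subsingleton (A i) := fun i => (hA i).1
  have hM := (hMA.realize_sentence _).2 (eComb_models_diagonalSentence (L := unaryLanguage α))
  let s : α → Bool := fun k => decide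
    (Structure.RelMap (predWithE k) ![a])
  have hs : ∀ k, Structure.RelMap (predWithE k) ![a] ↔
      s k = true := fun k => decide_eq_true_iff.symm
  refine ⟨s, mem_closure_iff.2 fun o ho hso => ?_, (completeTheory_eClass hM a hs).symm⟩
  obtain ⟨J, u, hu, huo⟩ := isOpen_pi_iff.1 ho s hso
  obtain ⟨⟨i, b⟩, hb⟩ := (realize_patternSentence J s _).1 <| (hMA.realize_sentence _).1 <|
    (realize_patternSentence J s M).2 ⟨a, fun k _ => hs k⟩
  refine ⟨t i, huo fun k hk => ?_, ht i⟩
  have : t i k = s k := by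
    rw [Bool.eq_iff_iff, ← hb k hk, relMap_pred_eComb, (hA i).2 k b]
  rw [this]
  exact (hu k hk).2

/-- In the ultrapower of the combination along an ultrafilter on `S` converging to `s`, the class of
`t ↦ (the point of t)` has pattern `s` by Łoś's theorem. -/
theorem image_pointTheory_subset_clE {α : Type} (S : Set (α → Bool)) :
    pointTheory '' closure S ⊆ ClE (pointTheory '' S) := by
  rintro _ ⟨s, hs, rfl⟩
  have := mem_closure_iff_comap_neBot.1 hs
  let u : Ultrafilter S := Ultrafilter.of (comap (↑) (𝓝 s))
  have hu : Tendsto (fun t : S => t.1) u (𝓝 s) := tendsto_comap.mono_left (Ultrafilter.of_le _)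
  let A : S → Type := fun t => Point t.1
  have : Nonempty (EComb A) := (nonempty_of_neBot (u : Filter S)).map fun t => ⟨t, default⟩
  let x : ∀ _ : S, EComb A := fun t => ⟨t, default⟩
  have hequiv : (withE (unaryLanguage α)).ElementarilyEquivalent ((u : Filter S).Product fun _ => EComb A)
      (EComb A) := by
    refine elementarilyEquivalent_iff.2 fun φ => ?_
    rw [Ultraproduct.sentence_realize]
    exact eventually_const
  refine ⟨S, A, inferInstance, (u : Filter S).Product fun _ => EComb A, inferInstance, x, fun t => inferInstance,
    fun t => ⟨t, t.2, rfl⟩, hequiv, ?_⟩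
  refine (completeTheory_eClass ((hequiv.realize_sentence _).2
    eComb_models_diagonalSentence) _ fun k => ?_).symm
  have h1 := Ultraproduct.realize_formula_cast (u := u) (M := fun _ => EComb A)
    ((predWithE k).formula₁
      (Term.var () : (withE (unaryLanguage α)).Term Unit)) (fun _ => x)
  simp only [Formula.realize_rel₁, Term.realize_var] at h1
  refine h1.trans ?_
  have h2 : ∀ᶠ t : S in u, t.1 k = s k := by
    have := (((continuous_apply k).tendsto s).comp hu).eventually_mem
      (mem_nhds_discrete.2 (Set.mem_singleton (s k)))
    exact this
  have h3 : ∀ t : S, Structure.RelMap (M := EComb A) (predWithE k) ![x t] ↔ t.1 k = true := fun t => relMap_pred_eComb k t _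
  simp only [h3]
  rw [eventually_congr (h2.mono fun t ht => by rw [ht]), eventually_const]

theorem clE_image_pointTheory {α : Type} (S : Set (α → Bool)) :
    ClE (pointTheory '' S) = pointTheory '' closure S :=
  (clE_image_pointTheory_subset S).antisymm (image_pointTheory_subset_clE S)

/-! ### Generating sets as dense subsets. -/

theorem isGenerating_image_pointTheory_iff {α : Type} {S K : Set (α → Bool)} :
    IsGenerating (pointTheory '' S) (pointTheory '' K) ↔ closure S = K := by
  rw [IsGenerating, clE_image_pointTheory, pointTheory_injective.image_injective.eq_iff,
    Set.image_subset_image_iff pointTheory_injective]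
  exact ⟨fun h => h.2, fun h => ⟨h ▸ subset_closure, h⟩⟩

/-- A dense subset of `K` contains every isolated point of `K`. -/
theorem hasLeastGenerating_of_isolated {α : Type} {D K : Set (α → Bool)} (hD : closure D = K)
    (hiso : ∀ d ∈ D, ∃ o, IsOpen o ∧ o ∩ K = {d}) : HasLeastGenerating (pointTheory '' K) := by
  have hK : IsClosed K := hD ▸ isClosed_closure
  have key : ∀ G, IsGenerating G (pointTheory '' K) → pointTheory '' D ⊆ G := by
    rintro G hG
    obtain ⟨S, -, rfl⟩ := Set.subset_image_iff.1 hG.1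
    rw [isGenerating_image_pointTheory_iff] at hG
    refine Set.image_mono fun d hd => ?_
    obtain ⟨o, ho, hoK⟩ := hiso d hd
    have hd : d ∈ o ∩ K := hoK ▸ rfl
    obtain ⟨z, hzo, hzS⟩ := mem_closure_iff.1 (hG ▸ hd.2) o ho hd.1
    have : z ∈ o ∩ K := ⟨hzo, hG ▸ subset_closure hzS⟩
    rw [hoK] at this
    exact this ▸ hzS
  exact ⟨pointTheory '' D, ⟨isGenerating_image_pointTheory_iff.2 hD,
    fun G hlt hG => hlt.2 (key G hG)⟩, key⟩

/-- No generating set is even minimal: it meets `o`, and a point it has there can be dropped without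
losing density. -/
theorem not_hasLeastGenerating_of_perfect {α : Type} {K o : Set (α → Bool)} (hK : IsClosed K)
    (ho : IsOpen o) (hne : (o ∩ K).Nonempty) (hper : Preperfect (o ∩ K)) :
    ¬ HasLeastGenerating (pointTheory '' K) := by
  rintro ⟨G, ⟨hG, hmin⟩, -⟩
  obtain ⟨S, -, rfl⟩ := Set.subset_image_iff.1 hG.1
  rw [isGenerating_image_pointTheory_iff] at hG
  obtain ⟨y, hyo, hyK⟩ := hne
  obtain ⟨z, hzo, hzS⟩ := mem_closure_iff.1 (hG ▸ hyK) o ho hyo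
  have hSK : S ⊆ K := hG ▸ subset_closure
  refine hmin (pointTheory '' (S \ {z})) ?_ (isGenerating_image_pointTheory_iff.2 ?_)
  · refine ⟨Set.image_mono Set.sdiff_subset, fun h => ?_⟩
    rw [Set.image_subset_image_iff pointTheory_injective] at h
    exact (h hzS).2 rfl
  · refine (closure_minimal (Set.sdiff_subset.trans hSK) hK).antisymm ?_
    rw [← hG]
    refine closure_minimal (fun w hw => ?_) isClosed_closure
    by_cases hwz : w = z
    · subst hwz
      refine mem_closure_iff.2 fun v hv hwv => ?_
      obtain ⟨p, ⟨hpv, hpo, hpK⟩, hpw⟩ := accPt_iff_nhds.1 (hper w ⟨hzo, hSK hw⟩) v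
        (hv.mem_nhds hwv)
      -- `p` need not lie in `S`; density near `p`, away from `w`, gives a point of `S` other than
      -- `w`.
      obtain ⟨q, ⟨hqv, hqw⟩, hqS⟩ := mem_closure_iff.1 (hG ▸ hpK) (v ∩ {w}ᶜ)
        (hv.inter isOpen_compl_singleton) ⟨hpv, hpw⟩
      exact ⟨q, hqv, hqS, hqw⟩
    · exact subset_closure ⟨hw, hwz⟩

/-! ### Expansions by further unary predicates. -/

/-- The renaming of unary predicates along a map of the indices. -/
def unaryMap {α β : Type} (g : α → β) : unaryLanguage α →ᴸ unaryLanguage β where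
  onFunction := fun _ f => f
  onRelation := fun n (r : UnarySymbol α n) => match n, r with
    | _, UnarySymbol.P k => UnarySymbol.P (g k)

theorem unaryMap_injective {α β : Type} {g : α → β} (hg : Function.Injective g) :
    (unaryMap g).Injective where
  onFunction := fun {_} _ _ h => h
  onRelation := fun {n} (r : UnarySymbol α n) (r' : UnarySymbol α n) h => by
    cases r with
    | P k =>
      cases r' with
      | P l => exact congrArg UnarySymbol.P (hg (UnarySymbol.P.inj h))

theorem isExpansion_pointTheory {α β : Type} (g : α → β) (s : β → Bool) :
    IsExpansion (unaryMap g) (pointTheory (s ∘ g)) (pointTheory s) := by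
  -- `Point s` and `Point (s ∘ g)` have the same carrier, so the latter is literally the reduct.
  let _ : (unaryLanguage α).Structure (Point s) := pointStructure (s ∘ g)
  have : (unaryMap g).IsExpansionOn (Point s) :=
    { map_onFunction := fun f => isEmptyElim f
      map_onRelation := fun {n} (r : UnarySymbol α n) x => by cases r; rfl }
  refine ⟨completeTheory.isMaximal _ _, Set.ext fun φ => ?_⟩
  exact ((unaryMap g).realize_onSentence (Point s) φ).symm

/-! ### The family with the least generating set. -/

/-- The points `(x, y)` of the Cantor space, split in two, such that `y` takes the value `true` at
most once, and, if it does so at `n`, then `x` vanishes from `n` on. -/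
def markedSet : Set (ℕ ⊕ ℕ → Bool) :=
  {s | (∀ n m, s (.inr n) = true → s (.inr m) = true → n = m) ∧
    ∀ n k, n ≤ k → s (.inr n) = true → s (.inl k) = false}

theorem isClosed_markedSet : IsClosed markedSet := by
  simp only [markedSet, Set.ofPred_and, Set.ofPred_forall]
  refine IsClosed.inter (isClosed_iInter fun n => isClosed_iInter fun m => ?_)
    (isClosed_iInter fun n => isClosed_iInter fun k => isClosed_iInter fun _ => ?_)
  · exact (isClosed_discrete {p : Bool × Bool | p.1 = true → p.2 = true → n = m}).preimage
      (f := fun s : ℕ ⊕ ℕ → Bool => (s (.inr n), s (.inr m))) (by fun_prop)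
  · exact (isClosed_discrete {p : Bool × Bool | p.1 = true → p.2 = false}).preimage
      (f := fun s : ℕ ⊕ ℕ → Bool => (s (.inr n), s (.inl k))) (by fun_prop)

theorem closure_marked : closure {s ∈ markedSet | ∃ n, s (.inr n) = true} = markedSet := by
  refine (closure_minimal (fun s hs => hs.1) isClosed_markedSet).antisymm fun s hs => ?_
  by_cases h : ∃ n, s (.inr n) = true
  · exact subset_closure ⟨hs, h⟩
  simp only [not_exists, Bool.not_eq_true] at h
  -- Truncate `x` at `n` and put the mark at `n`; each coordinate is correct once `n` exceeds its
  -- index.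
  let t : ℕ → ℕ ⊕ ℕ → Bool := fun n =>
    Sum.elim (fun k => if n ≤ k then false else s (.inl k)) fun m => decide (m = n)
  refine mem_closure_of_tendsto (f := t) (b := atTop) (tendsto_pi_nhds.2 fun i => ?_)
    (Eventually.of_forall fun n => ⟨⟨?_, ?_⟩, n, by simp [t]⟩)
  · refine tendsto_nhds_of_eventually_eq ((eventually_gt_atTop (i.elim id id)).mono fun n hn => ?_)
    rcases i with k | m
    · simp [t, show ¬ n ≤ k from not_le.2 hn]
    · simp [t, h m, show m ≠ n from ne_of_lt hn]
  · intro a b ha hb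
    simp only [t, Sum.elim_inr, decide_eq_true_eq] at ha hb
    rw [ha, hb]
  · intro a k hak ha
    simp only [t, Sum.elim_inr, decide_eq_true_eq] at ha
    simp [t, ← ha, hak]

/-- A mark at `n` forces all coordinates except `x` below `n`, so finitely many values determine the
point. -/
theorem exists_isOpen_inter_markedSet_eq_singleton {s : ℕ ⊕ ℕ → Bool} (hs : s ∈ markedSet) {n : ℕ}
    (hn : s (.inr n) = true) : ∃ o, IsOpen o ∧ o ∩ markedSet = {s} := by
  let J : Finset (ℕ ⊕ ℕ) := insert (.inr n) ((Finset.range n).map Function.Embedding.inl)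
  refine ⟨(J : Set (ℕ ⊕ ℕ)).pi fun i => {s i},
    isOpen_set_pi J.finite_toSet fun _ _ => isOpen_discrete _, ?_⟩
  refine Set.eq_singleton_iff_unique_mem.2 ⟨⟨fun i _ => rfl, hs⟩, ?_⟩
  rintro z ⟨hz, hzK⟩
  have hzn : z (.inr n) = true := (hz (.inr n) (by simp [J])).trans hn
  funext i
  rcases i with k | m
  · by_cases hk : k < n
    · exact hz (.inl k) (by simp [J, hk])
    · rw [hzK.2 n k (not_lt.1 hk) hzn, hs.2 n k (not_lt.1 hk) hn]
  · by_cases hm : m = n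
    · rw [hm, hzn, hn]
    · rw [Bool.eq_iff_iff]
      exact ⟨fun h => (hm (hzK.1 _ _ h hzn)).elim, fun h => (hm (hs.1 _ _ h hn)).elim⟩

/-! ### The expansion without the least generating set. -/

open Classical in
/-- The additional coordinate says whether the second half of the point vanishes. -/
noncomputable def markVanishing (s : ℕ ⊕ ℕ → Bool) (i : Option (ℕ ⊕ ℕ)) : Bool :=
  i.elim (decide (∀ n, s (.inr n) = false)) s

theorem comp_some_mem_markedSet {z : Option (ℕ ⊕ ℕ) → Bool}
    (hz : z ∈ closure (markVanishing '' markedSet)) : z ∘ some ∈ markedSet := by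
  have h : IsClosed {z : Option (ℕ ⊕ ℕ) → Bool | z ∘ some ∈ markedSet} :=
    isClosed_markedSet.preimage (continuous_pi fun i => continuous_apply (some i))
  refine closure_minimal ?_ h hz
  rintro _ ⟨s, hs, rfl⟩
  exact hs

theorem inter_closure_image_markVanishing :
    {z | z none = true} ∩ closure (markVanishing '' markedSet) =
      {z | z none = true ∧ ∀ n, z (some (.inr n)) = false} := by
  ext z
  refine and_congr_right fun h0 => ⟨fun hz n => ?_, fun h => subset_closure ⟨z ∘ some, ?_, ?_⟩⟩
  · have h : IsClosed {z : Option (ℕ ⊕ ℕ) → Bool | z none = true → z (some (.inr n)) = false} :=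
      (isClosed_discrete {p : Bool × Bool | p.1 = true → p.2 = false}).preimage
        (f := fun z : Option (ℕ ⊕ ℕ) → Bool => (z none, z (some (.inr n)))) (by fun_prop)
    refine closure_minimal ?_ h hz h0
    rintro _ ⟨s, -, rfl⟩ hs
    simp only [markVanishing, Option.elim_none, decide_eq_true_eq] at hs
    exact hs n
  · exact ⟨fun n m hn => by simp [h n] at hn, fun n k _ hn => by simp [h n] at hn⟩
  · funext i
    cases i with
    | none =>
      have h0 : z none = true := h0
      simp [markVanishing, h, h0]
    | some i => rfl

/-- On this part `x` is unconstrained: flipping its `k`-th coordinate gives other points of the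
part, tending to `z` as `k` grows. -/
theorem preperfect_inter_closure_image_markVanishing :
    Preperfect ({z | z none = true} ∩ closure (markVanishing '' markedSet)) := by
  rw [inter_closure_image_markVanishing]
  rintro z ⟨h0, hz⟩
  let w : ℕ → Option (ℕ ⊕ ℕ) → Bool := fun k =>
    Function.update z (some (.inl k)) (!z (some (.inl k)))
  have hw : Tendsto w atTop (𝓝 z) := by
    refine tendsto_pi_nhds.2 fun i => tendsto_nhds_of_eventually_eq ?_
    refine (eventually_gt_atTop (i.elim 0 (Sum.elim id id))).mono fun k hk => ?_
    refine Function.update_of_ne (fun h => ?_) _ _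
    subst h
    exact lt_irrefl k hk
  refine accPt_iff_nhds.2 fun v hv => ?_
  obtain ⟨k, hk⟩ := (hw.eventually_mem hv).exists
  refine ⟨w k, ⟨hk, by simpa [w] using h0, fun n => by simpa [w] using hz n⟩, fun h => ?_⟩
  simpa [w] using congrFun h (some (.inl k))

theorem proposition3p4 :
    ∃ (L₀ L₁ : FirstOrder.Language.{0, 0}) (_ : IsPredicateLanguage L₀) (_ : IsPredicateLanguage L₁)
      (ι : L₀ →ᴸ L₁) (𝒯₀ : Set L₀.Theory) (𝒯₁ : Set L₁.Theory) (e : L₀.Theory → L₁.Theory),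
      ι.Injective ∧
      IsEClosed 𝒯₀ ∧ HasLeastGenerating 𝒯₀ ∧
      (∀ T ∈ 𝒯₀, IsExpansion ι T (e T)) ∧ 𝒯₁ = ClE (e '' 𝒯₀) ∧
      IsEClosed 𝒯₁ ∧ (∀ T' ∈ 𝒯₁, ∃ T ∈ 𝒯₀, IsExpansion ι T T') ∧
      ¬ HasLeastGenerating 𝒯₁ := by
  refine ⟨unaryLanguage (ℕ ⊕ ℕ), unaryLanguage (Option (ℕ ⊕ ℕ)), inferInstance, inferInstance,
    unaryMap some, pointTheory '' markedSet,
    pointTheory '' closure (markVanishing '' markedSet),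
    -- `trueSet` inverts `pointTheory`, which lets the expansion be defined on all theories.
    fun T => pointTheory (markVanishing (trueSet T)),
    unaryMap_injective (Option.some_injective _), ?_, ?_, ?_, ?_, ?_, ?_, ?_⟩
  · rw [IsEClosed, clE_image_pointTheory, isClosed_markedSet.closure_eq]
  · exact hasLeastGenerating_of_isolated closure_marked fun s ⟨hs, n, hn⟩ =>
      exists_isOpen_inter_markedSet_eq_singleton hs hn
  · rintro _ ⟨s, -, rfl⟩
    simp only [trueSet_pointTheory]
    exact isExpansion_pointTheory some (markVanishing s)
  · rw [← clE_image_pointTheory, Set.image_image, Set.image_image]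
    simp only [trueSet_pointTheory]
  · rw [IsEClosed, clE_image_pointTheory, closure_closure]
  · rintro _ ⟨z, hz, rfl⟩
    exact ⟨_, ⟨_, comp_some_mem_markedSet hz, rfl⟩, isExpansion_pointTheory some z⟩
  · refine not_hasLeastGenerating_of_perfect (o := {z | z none = true})
      isClosed_closure ((isOpen_discrete ({true} : Set Bool)).preimage
        (f := fun z : Option (ℕ ⊕ ℕ) → Bool => z none) (continuous_apply none)) ?_
      preperfect_inter_closure_image_markVanishing
    -- The point with only the new predicate true.
    refine ⟨fun i => i.isNone, ?_⟩
    rw [inter_closure_image_markVanishing]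
    exact ⟨rfl, fun _ => rfl⟩
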